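/- For a topological space $Z$, let $\mathcal M_\tau(Z)$ be the set of $\tau$-additive Borel probability measures on $Z$, i.e. Borel probability measures $\mu$ with $\mu(\bigcup\mathcal U)=\sup_{U\in\mathcal U}\mu(U)$ for every non-empty upwards directed family $\mathcal U$ of open sets. For $\mu\in\mathcal M_\tau(Y)$ and $\nu\in\mathcal M_\tau(Z)$, let $\mu\times\nu$ be the unique $\tau$-additive Borel probability measure on the topological product $Y\times Z$ with $(\mu\times\nu)(A\times B)=\mu(A)\,\nu(B)$ for all open $A\subseteq Y$, $B\subseteq Z$. If a topological group $G$ acts continuously on a topological space $X$ via $\pi:G\times X\to X$, the convolution of $\mu\in\mathcal M_\tau(G)$ and $\nu\in\mathcal M_\tau(X)$ is the measure $\mu*\nu\in\mathcal M_\tau(X)$ given by $(\mu*\nu)(E)=(\mu\times\nu)(\pi^{-1}[E])$ for Borel $E\subseteq X$; for $\mu_1,\mu_2\in\mathcal M_\tau(G)$, the measure $\mu_1*\mu_2\in\mathcal M_\tau(G)$ is the convolution for the action of $G$ on itself by left multiplication. **Lemma.** Let a topological group $G$ act (jointly) continuously on a regular topological space $X$, let $\mu_1,\mu_2\in\mathcal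 M_\tau(G)$ and $\nu\in\mathcal M_\tau(X)$. Then $$(\mu_1*\mu_2)*\nu=\mu_1*(\mu_2*\nu).$$ Moreover, $\delta_1*\nu=\nu$, where $\delta_1$ is the Dirac measure at the neutral element $1$ of $G$. -/

import Mathlib

open Set MeasureTheory
open scoped ENNReal

/-- A Borel measure `μ` on a topological space `X` is `τ`-additive if
`μ (⋃ 𝒢) = sup {μ U | U ∈ 𝒢}` for every non-empty upwards directed family `𝒢` of open sets.
(Open sets, hence also their unions, are always measurable for a Borel measure.) -/
def IsTauAdditive {X : Type*} [TopologicalSpace X] (μ : @Measure X (borel X)) : Prop :=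
  ∀ 𝒢 : Set (Set X), 𝒢.Nonempty → DirectedOn (· ⊆ ·) 𝒢 → (∀ U ∈ 𝒢, IsOpen U) →
    μ (⋃₀ 𝒢) = ⨆ U ∈ 𝒢, μ U

/-- `TauMeasure X` is the set of all `τ`-additive Borel probability measures on `X`. -/
@[ext]
structure TauMeasure (X : Type*) [TopologicalSpace X] where
  /-- The underlying Borel measure. -/
  toMeasure : @Measure X (borel X)
  isProbabilityMeasure : IsProbabilityMeasure toMeasure
  isTauAdditive : IsTauAdditive toMeasure

namespace TauMeasure

variable {X Y G : Type*} [TopologicalSpace X] [TopologicalSpace Y]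

/-- The Dirac measure at a point. -/
noncomputable def dirac (x : X) : TauMeasure X where
  toMeasure := @Measure.dirac X (borel X) x
  isProbabilityMeasure := @Measure.dirac.isProbabilityMeasure X (borel X) x
  isTauAdditive := by
    let : MeasurableSpace X := borel X
    have : BorelSpace X := ⟨rfl⟩
    intro 𝒢 _ _ ho
    rw [Measure.dirac_apply' x (isOpen_sUnion ho).measurableSet]
    have h : ∀ U ∈ 𝒢, Measure.dirac x U = U.indicator (1 : X → ℝ≥0∞) x := fun U hU =>
      Measure.dirac_apply' x (ho U hU).measurableSet
    rw [biSup_congr h]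
    apply le_antisymm
    · by_cases hx : x ∈ ⋃₀ 𝒢
      · obtain ⟨U, hU, hxU⟩ := hx
        refine le_trans ?_ (le_iSup₂ U hU)
        rw [indicator_of_mem hxU]
        exact indicator_le_self' (fun _ _ => zero_le) x
      · simp [hx]
    · refine iSup₂_le fun U hU => ?_
      exact indicator_le_indicator_of_subset (subset_sUnion_of_mem hU) (fun _ => zero_le) x

/-- The push-forward `E ↦ μ (f⁻¹ E)` of a `τ`-additive Borel probability measure under a
continuous map. -/
noncomputable def map (f : X → Y) (hf : Continuous f) (μ : TauMeasure X) : TauMeasure Y where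
  toMeasure := @Measure.map X Y (borel X) (borel Y) f μ.toMeasure
  isProbabilityMeasure := by
    let : MeasurableSpace X := borel X
    have : BorelSpace X := ⟨rfl⟩
    let : MeasurableSpace Y := borel Y
    have : BorelSpace Y := ⟨rfl⟩
    have := μ.isProbabilityMeasure
    exact Measure.isProbabilityMeasure_map hf.measurable.aemeasurable
  isTauAdditive := by
    let : MeasurableSpace X := borel X
    have : BorelSpace X := ⟨rfl⟩
    let : MeasurableSpace Y := borel Y
    have : BorelSpace Y := ⟨rfl⟩
    intro 𝒢 hne hd ho
    rw [Measure.map_apply hf.measurable (isOpen_sUnion ho).measurableSet, preimage_sUnion]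
    have h : ∀ U ∈ 𝒢, Measure.map f μ.toMeasure U = μ.toMeasure (f ⁻¹' U) := fun U hU =>
      Measure.map_apply hf.measurable (ho U hU).measurableSet
    rw [biSup_congr h, ← sUnion_image, μ.isTauAdditive ((f ⁻¹' ·) '' 𝒢) (hne.image _), iSup_image]
    · rintro _ ⟨U, hU, rfl⟩ _ ⟨V, hV, rfl⟩
      obtain ⟨W, hW, h1, h2⟩ := hd U hU V hV
      exact ⟨_, ⟨W, hW, rfl⟩, preimage_mono h1, preimage_mono h2⟩
    · rintro _ ⟨U, hU, rfl⟩
      exact (ho U hU).preimage hf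

/-- `ρ` is a product of `μ` and `ν`: a `τ`-additive Borel probability measure on `X × Y`, for the
Borel `σ`-algebra of the product topology (which may be strictly larger than the product of the
two Borel `σ`-algebras), with `ρ (A × B) = μ A * ν B` for all open sets `A` and `B`. -/
def IsProd (μ : TauMeasure X) (ν : TauMeasure Y) (ρ : TauMeasure (X × Y)) : Prop :=
  ∀ (A : Set X) (B : Set Y), IsOpen A → IsOpen B →
    ρ.toMeasure (A ×ˢ B) = μ.toMeasure A * ν.toMeasure B

/-! Existence and uniqueness of the product. -/

theorem iSup_of_directed (μ : TauMeasure X) {ι : Type*} [Nonempty ι] (s : ι → Set X)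
    (hd : Directed (· ⊆ ·) s) (ho : ∀ i, IsOpen (s i)) :
    μ.toMeasure (⋃ i, s i) = ⨆ i, μ.toMeasure (s i) := by
  rw [← sUnion_range, μ.isTauAdditive (range s) (range_nonempty s) hd.directedOn_range
    (by rintro _ ⟨i, rfl⟩; exact ho i), iSup_range]

theorem lowerSemicontinuous_section (ν : TauMeasure Y) {W : Set (X × Y)} (hW : IsOpen W) :
    LowerSemicontinuous fun x : X => ν.toMeasure (Prod.mk x ⁻¹' W) := by
  intro x a ha
  let 𝒢 : Set (Set Y) := {B | IsOpen B ∧ ∃ A : Set X, IsOpen A ∧ x ∈ A ∧ A ×ˢ B ⊆ W}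
  have hU : ⋃₀ 𝒢 = Prod.mk x ⁻¹' W := by
    ext y
    constructor
    · rintro ⟨B, ⟨_, A, _, hxA, hAB⟩, hy⟩
      exact hAB ⟨hxA, hy⟩
    · intro hy
      obtain ⟨A, B, hA, hB, hx, hy', h⟩ := isOpen_prod_iff.1 hW x y hy
      exact ⟨B, ⟨hB, A, hA, hx, h⟩, hy'⟩
  have hne : 𝒢.Nonempty := ⟨∅, isOpen_empty, univ, isOpen_univ, mem_univ _, by simp⟩
  have hd : DirectedOn (· ⊆ ·) 𝒢 := by
    rintro B₁ ⟨hB₁, A₁, hA₁, hx₁, h₁⟩ B₂ ⟨hB₂, A₂, hA₂, hx₂, h₂⟩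
    refine ⟨B₁ ∪ B₂, ⟨hB₁.union hB₂, A₁ ∩ A₂, hA₁.inter hA₂, ⟨hx₁, hx₂⟩, ?_⟩,
      subset_union_left, subset_union_right⟩
    rintro ⟨x', y'⟩ ⟨⟨h1, h2⟩, h3 | h3⟩
    · exact h₁ ⟨h1, h3⟩
    · exact h₂ ⟨h2, h3⟩
  change a < _ at ha
  beta_reduce at ha
  rw [← hU, ν.isTauAdditive 𝒢 hne hd fun U hU => hU.1] at ha
  obtain ⟨B, hB⟩ := lt_iSup_iff.1 ha
  obtain ⟨⟨_, A, hA, hxA, hAB⟩, haB⟩ := lt_iSup_iff.1 hB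
  filter_upwards [hA.mem_nhds hxA] with x' hx'
  exact haB.trans_le (measure_mono fun y hy => hAB ⟨hx', hy⟩)

theorem measurableSet_section {W : Set (X × Y)} (hW : MeasurableSet[borel (X × Y)] W) (x : X) :
    MeasurableSet[borel Y] (Prod.mk x ⁻¹' W) := by
  let : MeasurableSpace Y := borel Y
  have : BorelSpace Y := ⟨rfl⟩
  let : MeasurableSpace (X × Y) := borel (X × Y)
  have : BorelSpace (X × Y) := ⟨rfl⟩
  have hc : Continuous (Prod.mk x : Y → X × Y) := by fun_prop
  exact hc.measurable hW

theorem measurable_section (ν : TauMeasure Y) {W : Set (X × Y)}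
    (hW : MeasurableSet[borel (X × Y)] W) :
    Measurable[borel X] fun x : X => ν.toMeasure (Prod.mk x ⁻¹' W) := by
  let : MeasurableSpace X := borel X
  have : BorelSpace X := ⟨rfl⟩
  have := ν.isProbabilityMeasure
  induction W, hW using MeasurableSpace.induction_on_inter (m := borel (X × Y)) rfl
    isPiSystem_isOpen with
  | empty => simp
  | basic t ht => exact (lowerSemicontinuous_section ν ht).measurable
  | compl t ht ih =>
    have : (fun x : X => ν.toMeasure (Prod.mk x ⁻¹' tᶜ)) =
        fun x : X => 1 - ν.toMeasure (Prod.mk x ⁻¹' t) := by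
      funext x
      rw [preimage_compl, prob_compl_eq_one_sub (measurableSet_section ht x)]
    rw [this]
    exact measurable_const.sub ih
  | iUnion f hd hm ih =>
    have : (fun x : X => ν.toMeasure (Prod.mk x ⁻¹' ⋃ i, f i)) =
        fun x : X => ∑' i, ν.toMeasure (Prod.mk x ⁻¹' f i) := by
      funext x
      rw [preimage_iUnion, measure_iUnion (fun i j hij => (hd hij).preimage _)
        fun i => measurableSet_section (hm i) x]
    rw [this]
    exact Measurable.tsum ih

theorem lintegral_iSup_of_directed (μ : TauMeasure X) {ι : Type*} [Nonempty ι]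
    (f : ι → X → ℝ≥0∞) (hd : Directed (· ≤ ·) f) (hf : ∀ i, LowerSemicontinuous (f i)) :
    ∫⁻ x, ⨆ i, f i x ∂μ.toMeasure = ⨆ i, ∫⁻ x, f i x ∂μ.toMeasure := by
  let : MeasurableSpace X := borel X
  have : BorelSpace X := ⟨rfl⟩
  have := μ.isProbabilityMeasure
  have hm : ∀ i, Measurable (f i) := fun i => (hf i).measurable
  apply le_antisymm _ (iSup_le fun i => lintegral_mono fun x => le_iSup (fun i => f i x) i)
  -- a sequence of indices that exhausts all superlevel sets of the supremum
  have hlev : ∀ q : ℚ, μ.toMeasure {x | ((q : ℝ).toNNReal : ℝ≥0∞) < ⨆ i, f i x} =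
      ⨆ i, μ.toMeasure {x | ((q : ℝ).toNNReal : ℝ≥0∞) < f i x} := by
    intro q
    rw [← μ.iSup_of_directed (fun i => {x | ((q : ℝ).toNNReal : ℝ≥0∞) < f i x})]
    · congr 1
      ext x
      simp [lt_iSup_iff]
    · intro i j
      obtain ⟨k, h1, h2⟩ := hd i j
      exact ⟨k, fun x hx => lt_of_lt_of_le hx (h1 x), fun x hx => lt_of_lt_of_le hx (h2 x)⟩
    · exact fun i => (hf i).isOpen_preimage _
  have hseq : ∀ q : ℚ, ∃ u : ℕ → ι, ⨆ n, μ.toMeasure {x | ((q : ℝ).toNNReal : ℝ≥0∞) < f (u n) x} =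
      ⨆ i, μ.toMeasure {x | ((q : ℝ).toNNReal : ℝ≥0∞) < f i x} := by
    intro q
    obtain ⟨v, -, hv, hmem⟩ := exists_seq_tendsto_sSup
      (range_nonempty fun i => μ.toMeasure {x | ((q : ℝ).toNNReal : ℝ≥0∞) < f i x}) (OrderTop.bddAbove _)
    choose u hu using hmem
    refine ⟨u, le_antisymm (iSup_le fun n => le_iSup
      (fun i => μ.toMeasure {x | ((q : ℝ).toNNReal : ℝ≥0∞) < f i x}) (u n)) ?_⟩
    rw [sSup_range] at hv
    refine le_of_tendsto' hv fun n => ?_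
    rw [← hu n]
    exact le_iSup (fun n => μ.toMeasure {x | ((q : ℝ).toNNReal : ℝ≥0∞) < f (u n) x}) n
  choose u hu using hseq
  obtain ⟨e, he⟩ := exists_surjective_nat (ℚ × ℕ)
  let g : ℕ → X → ℝ≥0∞ := fun n => f (u (e n).1 (e n).2)
  have hgm : ∀ n, Measurable (g n) := fun n => hm _
  have hle : ∀ x, ⨆ n, g n x ≤ ⨆ i, f i x := fun x =>
    iSup_le fun n => le_iSup (fun i => f i x) _
  have hnull : ∀ q : ℚ, μ.toMeasure
      ({x | ((q : ℝ).toNNReal : ℝ≥0∞) < ⨆ i, f i x} \ {x | ((q : ℝ).toNNReal : ℝ≥0∞) < ⨆ n, g n x}) = 0 := by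
    intro q
    have hsub : {x | ((q : ℝ).toNNReal : ℝ≥0∞) < ⨆ n, g n x} ⊆ {x | ((q : ℝ).toNNReal : ℝ≥0∞) < ⨆ i, f i x} :=
      fun x hx => lt_of_lt_of_le hx (hle x)
    have hms : MeasurableSet {x | ((q : ℝ).toNNReal : ℝ≥0∞) < ⨆ n, g n x} :=
      measurableSet_lt measurable_const (Measurable.iSup hgm)
    rw [measure_sdiff hsub hms.nullMeasurableSet (measure_ne_top _ _), tsub_eq_zero_iff_le, hlev,
      ← hu]
    refine iSup_le fun n => measure_mono fun x hx => ?_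
    obtain ⟨k, hk⟩ := he (q, n)
    refine lt_of_lt_of_le hx (le_trans (le_of_eq ?_) (le_iSup (fun n => g n x) k))
    simp [g, hk]
  have hae : ∀ᵐ x ∂μ.toMeasure, ⨆ i, f i x ≤ ⨆ n, g n x := by
    rw [← measure_iUnion_null_iff] at hnull
    refine measure_mono_null (fun x hx => ?_) hnull
    simp only [mem_compl_iff, mem_ofPred_eq, not_le] at hx
    obtain ⟨q, -, h1, h2⟩ := ENNReal.lt_iff_exists_rat_btwn.1 hx
    exact mem_iUnion.2 ⟨q, h2, fun h => (lt_of_lt_of_le h le_rfl).not_gt h1⟩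
  refine (lintegral_mono_ae hae).trans ?_
  have hps : ∀ x, ⨆ n, g n x = ⨆ n, partialSups g n x := by
    intro x
    have := congrFun (iSup_partialSups_eq g) x
    simpa [iSup_apply] using this.symm
  simp_rw [hps]
  rw [lintegral_iSup]
  · refine iSup_le fun n => ?_
    obtain ⟨i, hi⟩ : ∃ i, partialSups g n ≤ f i := by
      induction n with
      | zero => exact ⟨_, (partialSups_zero g).le⟩
      | succ n ih =>
        obtain ⟨i, hi⟩ := ih
        obtain ⟨k, h1, h2⟩ := hd i (u (e (n + 1)).1 (e (n + 1)).2)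
        refine ⟨k, ?_⟩
        rw [partialSups_add_one]
        exact sup_le (hi.trans h1) h2
    exact (lintegral_mono hi).trans (le_iSup (fun i => ∫⁻ x, f i x ∂μ.toMeasure) i)
  · intro n
    induction n with
    | zero => rw [partialSups_zero]; exact hgm 0
    | succ n ih => rw [partialSups_add_one]; exact ih.sup (hgm _)
  · exact (partialSups g).monotone

theorem exists_isProd (μ : TauMeasure X) (ν : TauMeasure Y) : ∃ ρ, IsProd μ ν ρ := by
  have := μ.isProbabilityMeasure
  have := ν.isProbabilityMeasure
  let ρ : @Measure (X × Y) (borel (X × Y)) :=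
    @Measure.ofMeasurable (X × Y) (borel (X × Y))
      (fun W _ => ∫⁻ x, ν.toMeasure (Prod.mk x ⁻¹' W) ∂μ.toMeasure) (by simp) (by
        intro f hm hd
        rw [← lintegral_tsum fun i => (measurable_section ν (hm i)).aemeasurable]
        refine lintegral_congr fun x => ?_
        rw [preimage_iUnion, measure_iUnion (fun i j hij => (hd hij).preimage _)
          fun i => measurableSet_section (hm i) x])
  have hρ : ∀ W : Set (X × Y), MeasurableSet[borel (X × Y)] W →
      ρ W = ∫⁻ x, ν.toMeasure (Prod.mk x ⁻¹' W) ∂μ.toMeasure := fun W hW =>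
    @Measure.ofMeasurable_apply _ (borel (X × Y)) _ _ _ W hW
  have hopen : ∀ W : Set (X × Y), IsOpen W → MeasurableSet[borel (X × Y)] W := fun W hW =>
    MeasurableSpace.measurableSet_generateFrom hW
  refine ⟨⟨ρ, ⟨?_⟩, ?_⟩, ?_⟩
  · rw [hρ univ (hopen _ isOpen_univ)]
    simp
  · intro 𝒢 hne hd ho
    have := hne.to_subtype
    rw [hρ _ (hopen _ (isOpen_sUnion ho)), iSup_subtype']
    have h1 : ∀ U : 𝒢, ρ U = ∫⁻ x, ν.toMeasure (Prod.mk x ⁻¹' (U : Set (X × Y))) ∂μ.toMeasure :=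
      fun U => hρ _ (hopen _ (ho U U.2))
    simp_rw [h1]
    rw [← lintegral_iSup_of_directed μ
      (fun (U : 𝒢) x => ν.toMeasure (Prod.mk x ⁻¹' (U : Set (X × Y))))]
    · refine lintegral_congr fun x => ?_
      rw [sUnion_eq_iUnion, preimage_iUnion, ν.iSup_of_directed]
      · intro U V
        obtain ⟨W, hW, h1, h2⟩ := hd U U.2 V V.2
        exact ⟨⟨W, hW⟩, preimage_mono h1, preimage_mono h2⟩
      · exact fun U => (ho U U.2).preimage (by fun_prop)
    · intro U V
      obtain ⟨W, hW, h1, h2⟩ := hd U U.2 V V.2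
      exact ⟨⟨W, hW⟩, fun x => measure_mono (preimage_mono h1),
        fun x => measure_mono (preimage_mono h2)⟩
    · exact fun U => lowerSemicontinuous_section ν (ho U U.2)
  · intro A B hA hB
    classical
    have hA' : MeasurableSet[borel X] A := MeasurableSpace.measurableSet_generateFrom hA
    change ρ (A ×ˢ B) = _
    rw [hρ _ (hopen _ (hA.prod hB))]
    have : (fun x : X => ν.toMeasure (Prod.mk x ⁻¹' A ×ˢ B)) =
        A.indicator fun _ => ν.toMeasure B := by
      funext x
      by_cases hx : x ∈ A
      · rw [mk_preimage_prod_right hx, indicator_of_mem hx]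
      · rw [mk_preimage_prod_right_eq_empty hx, indicator_of_notMem hx, measure_empty]
    rw [this, lintegral_indicator hA', setLIntegral_const, mul_comm]

theorem IsProd.unique {μ : TauMeasure X} {ν : TauMeasure Y} {ρ₁ ρ₂ : TauMeasure (X × Y)}
    (h₁ : IsProd μ ν ρ₁) (h₂ : IsProd μ ν ρ₂) : ρ₁ = ρ₂ := by
  have := ρ₁.isProbabilityMeasure
  have := ρ₂.isProbabilityMeasure
  let R : Set (Set (X × Y)) := {W | ∃ A B, IsOpen A ∧ IsOpen B ∧ W = A ×ˢ B}
  have hRo : ∀ W ∈ R, IsOpen W := by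
    rintro _ ⟨A, B, hA, hB, rfl⟩
    exact hA.prod hB
  have hpi : IsPiSystem R := by
    rintro _ ⟨A, B, hA, hB, rfl⟩ _ ⟨A', B', hA', hB', rfl⟩ -
    exact ⟨A ∩ A', B ∩ B', hA.inter hA', hB.inter hB', prod_inter_prod⟩
  have hopen : ∀ W : Set (X × Y), IsOpen W → MeasurableSet[borel (X × Y)] W := fun W hW =>
    MeasurableSpace.measurableSet_generateFrom hW
  have hle : MeasurableSpace.generateFrom R ≤ borel (X × Y) :=
    MeasurableSpace.generateFrom_le fun W hW => hopen W (hRo W hW)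
  have hgen : ∀ W, MeasurableSet[MeasurableSpace.generateFrom R] W →
      ρ₁.toMeasure W = ρ₂.toMeasure W := by
    intro W hW
    refine @ext_on_measurableSpace_of_generate_finite (X × Y) (borel (X × Y)) ρ₁.toMeasure
      ρ₂.toMeasure _ R ?_ (MeasurableSpace.generateFrom R) hle rfl hpi ?_ W hW
    · rintro _ ⟨A, B, hA, hB, rfl⟩
      rw [h₁ A B hA hB, h₂ A B hA hB]
    · rw [measure_univ, measure_univ]
  have hop : ∀ W, IsOpen W → ρ₁.toMeasure W = ρ₂.toMeasure W := by
    intro W hW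
    let 𝒢 : Set (Set (X × Y)) :=
      {V | IsOpen V ∧ V ⊆ W ∧ MeasurableSet[MeasurableSpace.generateFrom R] V}
    have hU : ⋃₀ 𝒢 = W := by
      refine subset_antisymm (sUnion_subset fun V hV => hV.2.1) ?_
      rintro ⟨x, y⟩ hxy
      obtain ⟨A, B, hA, hB, hx, hy, h⟩ := isOpen_prod_iff.1 hW x y hxy
      exact ⟨A ×ˢ B, ⟨hA.prod hB, h,
        MeasurableSpace.measurableSet_generateFrom ⟨A, B, hA, hB, rfl⟩⟩, hx, hy⟩
    have hne : 𝒢.Nonempty := ⟨∅, isOpen_empty, empty_subset _,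
      @MeasurableSet.empty _ (MeasurableSpace.generateFrom R)⟩
    have hd : DirectedOn (· ⊆ ·) 𝒢 := fun V hV V' hV' =>
      ⟨V ∪ V', ⟨hV.1.union hV'.1, union_subset hV.2.1 hV'.2.1,
        @MeasurableSet.union _ (MeasurableSpace.generateFrom R) _ _ hV.2.2 hV'.2.2⟩,
        subset_union_left, subset_union_right⟩
    have hs : ∀ V ∈ 𝒢, IsOpen V := fun V hV => hV.1
    rw [← hU, ρ₁.isTauAdditive 𝒢 hne hd hs, ρ₂.isTauAdditive 𝒢 hne hd hs]
    exact biSup_congr fun V hV => hgen V hV.2.2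
  refine TauMeasure.ext (@ext_of_generate_finite (X × Y) (borel (X × Y)) ρ₁.toMeasure ρ₂.toMeasure
    {W | IsOpen W} rfl isPiSystem_isOpen _ (fun W hW => hop W hW) ?_)
  rw [measure_univ, measure_univ]

theorem existsUnique_isProd (μ : TauMeasure X) (ν : TauMeasure Y) : ∃! ρ, IsProd μ ν ρ := by
  obtain ⟨ρ, hρ⟩ := exists_isProd μ ν
  exact ⟨ρ, hρ, fun _ h => IsProd.unique h hρ⟩

/-- The product measure `μ × ν`: the unique `τ`-additive Borel probability measure on `X × Y`
with `(μ × ν) (A × B) = μ A * ν B` for all open sets `A` and `B`. -/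
noncomputable def prod (μ : TauMeasure X) (ν : TauMeasure Y) : TauMeasure (X × Y) :=
  (existsUnique_isProd μ ν).choose

theorem isProd_prod (μ : TauMeasure X) (ν : TauMeasure Y) : IsProd μ ν (prod μ ν) :=
  (existsUnique_isProd μ ν).choose_spec.1

/-- The convolution `μ ∗ ν` along a continuous action `G × X → X`, `(g, x) ↦ g • x`:
the measure `E ↦ (μ × ν) {(g, x) | g • x ∈ E}`. -/
noncomputable def conv [TopologicalSpace G] [SMul G X] [ContinuousSMul G X]
    (μ : TauMeasure G) (ν : TauMeasure X) : TauMeasure X :=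
  map (fun p : G × X => p.1 • p.2) continuous_smul (prod μ ν)

theorem conv_apply [TopologicalSpace G] [SMul G X] [ContinuousSMul G X]
    (μ : TauMeasure G) (ν : TauMeasure X) {E : Set X} (hE : MeasurableSet[borel X] E) :
    (conv μ ν).toMeasure E = (prod μ ν).toMeasure ((fun p : G × X => p.1 • p.2) ⁻¹' E) := by
  let : MeasurableSpace X := borel X
  have : BorelSpace X := ⟨rfl⟩
  let : MeasurableSpace (G × X) := borel (G × X)
  have : BorelSpace (G × X) := ⟨rfl⟩
  exact Measure.map_apply (continuous_smul (M := G) (X := X)).measurable hE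

end TauMeasure

/-! Both sides of the associativity law are images of one measure on a triple product. Since
τ-additive products are natural under continuous maps (`prod_map_map`), each inner convolution can
be pulled out of its product as a push-forward: the left side becomes the image of `(μ₁ × μ₂) × ν`
under `((g, h), x) ↦ (gh)x`, the right side the image of `μ₁ × (μ₂ × ν)` under `(g, (h, x)) ↦
g(hx)`. Rebracketing carries the first triple product to the second (`map_prodAssoc_prod`), and the
two maps then agree by the action law. Likewise `δ₁ × ν` is the image of `ν` under `x ↦ (1, x)`
(`dirac_prod`), and `1x = x`.

Every identity of measures is checked on open sets only, or just on open boxes: τ-additivity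
determines a measure from its values on an intersection-stable basis, even where that basis does not
generate the Borel σ-algebra. -/

namespace TauMeasure

/-- Two `τ`-additive probability measures that agree on a basis of the topology which is closed
under finite intersections are equal. -/
theorem ext_of_isTopologicalBasis {X : Type*} [TopologicalSpace X] {R : Set (Set X)}
    (hR : TopologicalSpace.IsTopologicalBasis R) (hpi : IsPiSystem R) {ρ₁ ρ₂ : TauMeasure X}
    (h : ∀ U ∈ R, ρ₁.toMeasure U = ρ₂.toMeasure U) : ρ₁ = ρ₂ := by
  have := ρ₁.isProbabilityMeasure
  have := ρ₂.isProbabilityMeasure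
  have hle : MeasurableSpace.generateFrom R ≤ borel X :=
    MeasurableSpace.generateFrom_le fun W hW =>
      MeasurableSpace.measurableSet_generateFrom (hR.isOpen hW)
  have hgen : ∀ W, MeasurableSet[MeasurableSpace.generateFrom R] W →
      ρ₁.toMeasure W = ρ₂.toMeasure W := fun W hW =>
    @ext_on_measurableSpace_of_generate_finite X (borel X) ρ₁.toMeasure
      ρ₂.toMeasure _ R h (MeasurableSpace.generateFrom R) hle rfl hpi
      (by rw [measure_univ, measure_univ]) W hW
  refine TauMeasure.ext (@ext_of_generate_finite X (borel X) ρ₁.toMeasure ρ₂.toMeasure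
    {W | IsOpen W} rfl isPiSystem_isOpen _ (fun W hW => ?_) (by rw [measure_univ, measure_univ]))
  -- The basis sets inside `W` need not form a directed family. Allowing all open subsets of `W` in
  -- the σ-algebra generated by `R` gives closure under finite unions, while `hgen` still applies to
  -- each member.
  let 𝒢 : Set (Set X) :=
    {V | IsOpen V ∧ V ⊆ W ∧ MeasurableSet[MeasurableSpace.generateFrom R] V}
  have hU : ⋃₀ 𝒢 = W := by
    refine subset_antisymm (sUnion_subset fun V hV => hV.2.1) fun x hx => ?_
    obtain ⟨V, hV, hxV, hVW⟩ := hR.exists_subset_of_mem_open hx hW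
    exact ⟨V, ⟨hR.isOpen hV, hVW, MeasurableSpace.measurableSet_generateFrom hV⟩, hxV⟩
  have hne : 𝒢.Nonempty := ⟨∅, isOpen_empty, empty_subset _,
    @MeasurableSet.empty _ (MeasurableSpace.generateFrom R)⟩
  have hd : DirectedOn (· ⊆ ·) 𝒢 := fun V hV V' hV' =>
    ⟨V ∪ V', ⟨hV.1.union hV'.1, union_subset hV.2.1 hV'.2.1,
      @MeasurableSet.union _ (MeasurableSpace.generateFrom R) _ _ hV.2.2 hV'.2.2⟩,
      subset_union_left, subset_union_right⟩
  rw [← hU, ρ₁.isTauAdditive 𝒢 hne hd fun V hV => hV.1,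
    ρ₂.isTauAdditive 𝒢 hne hd fun V hV => hV.1]
  exact biSup_congr fun V hV => hgen V hV.2.2

/-! ### Push-forwards and their compatibility with products. -/

section Map

variable {X Y Z W : Type*} [TopologicalSpace X] [TopologicalSpace Y] [TopologicalSpace Z]
  [TopologicalSpace W]

theorem map_apply {f : X → Y} (hf : Continuous f) (μ : TauMeasure X) {E : Set Y}
    (hE : MeasurableSet[borel Y] E) : (map f hf μ).toMeasure E = μ.toMeasure (f ⁻¹' E) := by
  let : MeasurableSpace X := borel X
  have : BorelSpace X := ⟨rfl⟩
  let : MeasurableSpace Y := borel Y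
  have : BorelSpace Y := ⟨rfl⟩
  exact Measure.map_apply hf.measurable hE

theorem map_apply_of_isOpen {f : X → Y} (hf : Continuous f) (μ : TauMeasure X) {U : Set Y}
    (hU : IsOpen U) : (map f hf μ).toMeasure U = μ.toMeasure (f ⁻¹' U) :=
  map_apply hf μ (MeasurableSpace.measurableSet_generateFrom hU)

theorem ext_of_isOpen {ρ₁ ρ₂ : TauMeasure X}
    (h : ∀ U, IsOpen U → ρ₁.toMeasure U = ρ₂.toMeasure U) : ρ₁ = ρ₂ :=
  ext_of_isTopologicalBasis TopologicalSpace.isTopologicalBasis_opens isPiSystem_isOpen h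

theorem map_map {f : X → Y} (hf : Continuous f) {g : Y → Z} (hg : Continuous g)
    (μ : TauMeasure X) : map g hg (map f hf μ) = map (g ∘ f) (hg.comp hf) μ :=
  ext_of_isOpen fun U hU => by
    rw [map_apply_of_isOpen hg _ hU, map_apply_of_isOpen hf _ (hU.preimage hg),
      map_apply_of_isOpen _ _ hU, preimage_comp]

theorem map_id (μ : TauMeasure X) : map id continuous_id μ = μ :=
  ext_of_isOpen fun U hU => by rw [map_apply_of_isOpen _ _ hU, preimage_id]

/-- The preimage of an open box under `Prod.map f g` is again an open box, so the push-forward has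
the defining property of the product, and uniqueness applies. -/
theorem prod_map_map {f : X → Y} (hf : Continuous f) {g : Z → W} (hg : Continuous g)
    (μ : TauMeasure X) (ν : TauMeasure Z) :
    prod (map f hf μ) (map g hg ν) = map (Prod.map f g) (hf.prodMap hg) (prod μ ν) :=
  (isProd_prod _ _).unique fun A B hA hB => by
    have hpre : Prod.map f g ⁻¹' A ×ˢ B = (f ⁻¹' A) ×ˢ (g ⁻¹' B) := rfl
    rw [map_apply_of_isOpen _ _ (hA.prod hB), hpre,
      isProd_prod μ ν _ _ (hA.preimage hf) (hB.preimage hg), map_apply_of_isOpen hf _ hA,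
      map_apply_of_isOpen hg _ hB]

/-- The slice of `A ×ˢ B` at `x` is `B` or empty according to whether `x ∈ A`, which matches the
factor `δ_x(A)`. -/
theorem dirac_prod (x : X) (ν : TauMeasure Y) :
    prod (dirac x) ν = map (Prod.mk x) (by fun_prop) ν :=
  (isProd_prod _ _).unique fun A B hA hB => by
    have hdirac : (dirac x).toMeasure A = A.indicator 1 x :=
      @Measure.dirac_apply' X (borel X) A x (MeasurableSpace.measurableSet_generateFrom hA)
    rw [map_apply_of_isOpen _ _ (hA.prod hB), hdirac]
    by_cases hx : x ∈ A
    · rw [mk_preimage_prod_right hx, indicator_of_mem hx, Pi.one_apply, one_mul]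
    · rw [mk_preimage_prod_right_eq_empty hx, indicator_of_notMem hx, measure_empty, zero_mul]

/-- Open boxes `A ×ˢ B ×ˢ C` form an intersection-stable basis, and on them both measures equal `μ A
* ν B * ρ C`. -/
theorem map_prodAssoc_prod (μ : TauMeasure X) (ν : TauMeasure Y) (ρ : TauMeasure Z) :
    map (Homeomorph.prodAssoc X Y Z) (Homeomorph.continuous _) (prod (prod μ ν) ρ) =
      prod μ (prod ν ρ) := by
  refine ext_of_isTopologicalBasis
    (TopologicalSpace.isTopologicalBasis_opens.prod
      (TopologicalSpace.isTopologicalBasis_opens.prod TopologicalSpace.isTopologicalBasis_opens))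
    (isPiSystem_isOpen.prod (isPiSystem_isOpen.prod isPiSystem_isOpen)) ?_
  rintro _ ⟨A, hA : IsOpen A, _, ⟨B, hB : IsOpen B, C, hC : IsOpen C, rfl⟩, rfl⟩
  have hpre : Homeomorph.prodAssoc X Y Z ⁻¹' (A ×ˢ B ×ˢ C) = (A ×ˢ B) ×ˢ C := by
    ext ⟨⟨x, y⟩, z⟩
    exact and_assoc.symm
  rw [map_apply_of_isOpen _ _ (hA.prod (hB.prod hC)), hpre,
    isProd_prod _ _ _ _ (hA.prod hB) hC, isProd_prod _ _ _ _ hA hB,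
    isProd_prod _ _ _ _ hA (hB.prod hC), isProd_prod _ _ _ _ hB hC, mul_assoc]

end Map

/-! ### Convolution along a continuous monoid action. -/

section Conv

variable {G X : Type*} [Monoid G] [TopologicalSpace G]
  [TopologicalSpace X] [MulAction G X] [ContinuousSMul G X]

theorem conv_assoc [ContinuousMul G] (μ₁ μ₂ : TauMeasure G) (ν : TauMeasure X) :
    conv (conv μ₁ μ₂) ν = conv μ₁ (conv μ₂ ν) := by
  have hl : prod (conv μ₁ μ₂) ν = map (Prod.map (fun p : G × G => p.1 • p.2) id)
      (continuous_smul.prodMap continuous_id) (prod (prod μ₁ μ₂) ν) := by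
    rw [← prod_map_map _ continuous_id, map_id, conv]
  have hr : prod μ₁ (conv μ₂ ν) = map (Prod.map id (fun p : G × X => p.1 • p.2))
      (continuous_id.prodMap continuous_smul) (prod μ₁ (prod μ₂ ν)) := by
    rw [← prod_map_map continuous_id, map_id, conv]
  -- After this both sides are push-forwards of `prod (prod μ₁ μ₂) ν`, so it remains to compare the
  -- two maps pointwise.
  rw [conv, hl, conv, hr, ← map_prodAssoc_prod, map_map, map_map, map_map]
  congr 1
  funext p
  -- The action of `G` on itself is multiplication by definition, so `(g • h) • x` unfolds to `(g *
  -- h) • x`.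
  exact mul_smul p.1.1 p.1.2 p.2

theorem dirac_one_conv (ν : TauMeasure X) : conv (dirac (1 : G)) ν = ν := by
  rw [conv, dirac_prod, map_map]
  convert map_id ν using 2
  funext x
  exact one_smul G x

end Conv

end TauMeasure

theorem mainTheorem3 {G X : Type*} [Group G] [TopologicalSpace G] [IsTopologicalGroup G]
    [TopologicalSpace X] [RegularSpace X] [MulAction G X] [ContinuousSMul G X]
    (μ₁ μ₂ : TauMeasure G) (ν : TauMeasure X) :
    TauMeasure.conv (TauMeasure.conv μ₁ μ₂) ν = TauMeasure.conv μ₁ (TauMeasure.conv μ₂ ν) ∧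
      TauMeasure.conv (TauMeasure.dirac (1 : G)) ν = ν :=
  ⟨TauMeasure.conv_assoc μ₁ μ₂ ν, TauMeasure.dirac_one_conv ν⟩
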